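/- There exists a regular Hausdorff topology $\tau$ on the countable set $\mathbb Q$ such that the space $X=(\mathbb Q,\tau)$ has weight exactly $\omega_1$, is not cometrizable, and is not stratifiable, and moreover: (1) if $\omega_1=\mathfrak c$, then every compact subset of $X$ is finite and $X$ is $\mathsf{cs}$-cosmic; (2) if $\omega_1<\mathfrak p$, then $X$ is Fréchet–Urysohn and not $\mathsf{cs}$-cosmic. Here a space $X$ is *cometrizable* if it admits a weaker metrizable topology $\sigma$ such that each point of $X$ has a (not necessarily open) neighborhood base in $X$ consisting of $\sigma$-closed sets. A regular Hausdorff space $X$ is *stratifiable* if each $x\in X$ has a sequence of open neighborhoods $(U_n(x))_{n\in\omega}$ such that $F=\bigcap_{n\in\omega}\overline{\bigcup_{x\in F}U_n(x)}$ for every closed $F\subseteq X$. A family $\mathcal N$ of subsets of $X$ is a *$\mathsf{cs}$-network* if for every open $U\subseteq X$ and every sequence $(x_n)_{n\in\omega}$ converging to a point of $U$ there is $N\in\mathcal N$ with $N\subseteq U$ and $\{n\in\omega:x_n\in N\}$ infinite; a regular Hausdorff space is *$\mathsf{cs}$-cosmic* if it has a countable $\mathsf{cs}$-network. $X$ is *Fréchet–Urysohn*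 if every point of the closure of a set $A\subseteq X$ is the limit of a sequence of points of $A$. The *weight* of a space is the least cardinality of a base; its *character* is the supremum over its points of the least cardinality of a neighborhood base at the point. $\mathfrak c$ is the cardinality of the continuum, and $\mathfrak p$ is the smallest character of a countable space with a unique non-isolated point which is not Fréchet–Urysohn. -/

import Mathlib

open Set Filter Topology Cardinal

/-- The weight of a topological space: the least cardinality of a base of the topology. -/
noncomputable def topWeight (X : Type*) [TopologicalSpace X] : Cardinal :=
  sInf {c | ∃ B : Set (Set X), TopologicalSpace.IsTopologicalBasis B ∧ c = #B}

/-- The character of `X` at the point `x`: the least cardinality of a (not necessarily open)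
neighborhood base at `x`. -/
noncomputable def characterAt {X : Type*} [TopologicalSpace X] (x : X) : Cardinal :=
  sInf {c | ∃ B : Set (Set X), (𝓝 x).HasBasis (fun V => V ∈ B) id ∧ c = #B}

/-- The character of a topological space: the supremum of the characters at its points. -/
noncomputable def topCharacter (X : Type*) [TopologicalSpace X] : Cardinal :=
  ⨆ x : X, characterAt x

/-- The cardinal `𝔭`: the smallest character of a countable space with a unique non-isolated
point which is not Fréchet–Urysohn. -/
noncomputable def cardinalP : Cardinal.{0} :=
  sInf {c | ∃ (X : Type) (_ : TopologicalSpace X), Countable X ∧ (∃! x : X, ¬ IsOpen {x}) ∧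
    ¬ FrechetUrysohnSpace X ∧ c = topCharacter X}

/-- A space is cometrizable if it admits a weaker metrizable topology `σ` such that each point
has a (not necessarily open) neighborhood base consisting of `σ`-closed sets. -/
def Cometrizable (X : Type*) [τ : TopologicalSpace X] : Prop :=
  ∃ σ : TopologicalSpace X, τ ≤ σ ∧ @TopologicalSpace.MetrizableSpace X σ ∧
    ∀ x : X, ∀ U ∈ @nhds X τ x, ∃ V ∈ @nhds X τ x, V ⊆ U ∧ IsClosed[σ] V

/-- A regular space is stratifiable if its points have open neighborhoods `U x n`, `n ∈ ℕ`, such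
that every closed set `F` equals the intersection over `n` of the closures of
`⋃ x ∈ F, U x n`. -/
def Stratifiable (X : Type*) [TopologicalSpace X] : Prop :=
  T3Space X ∧ ∃ U : X → ℕ → Set X, (∀ x n, IsOpen (U x n) ∧ x ∈ U x n) ∧
    ∀ F : Set X, IsClosed F → F = ⋂ n, closure (⋃ x ∈ F, U x n)

/-- A family of sets `N` is a `cs`-network if for every open set `U` and every sequence `s`
converging to a point of `U`, some member of `N` lies in `U` and contains `s n` for infinitely
many `n`. -/
def IsCsNetwork {X : Type*} [TopologicalSpace X] (N : Set (Set X)) : Prop :=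
  ∀ U : Set X, IsOpen U → ∀ x ∈ U, ∀ s : ℕ → X, Tendsto s atTop (𝓝 x) →
    ∃ M ∈ N, M ⊆ U ∧ {n | s n ∈ M}.Infinite

/-- A regular space is `cs`-cosmic if it has a countable `cs`-network. -/
def CsCosmic (X : Type*) [TopologicalSpace X] : Prop :=
  T3Space X ∧ ∃ N : Set (Set X), N.Countable ∧ IsCsNetwork N

/-! The space is a countable dense subset of the Cantor cube `Z → Bool` with `Z` of size ω₁.
Cometrizability, stratifiability, countable weight, and being Fréchet–Urysohn and `cs`-cosmic at
once all yield a countable cobase, which density in an uncountable power forbids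
(`not_hasCountableCobase`). Weight at most ω₁ gives Fréchet–Urysohn when ω₁ < 𝔭.

If ω₁ = 𝔠, then `Z` is the whole Cantor set and the points are continuous functions, prescribed on
at most `n` cylinders of length `n` and equal to the `n`-th coordinate elsewhere. This leaves room
for density, while Baire category excludes injective convergent sequences; hence compact sets are
finite. -/

/-- A countable family of open sets such that every point has a neighborhood base of sets whose
complements are unions of members of the family. -/
def HasCountableCobase (X : Type*) [TopologicalSpace X] : Prop :=
  ∃ 𝒰 : Set (Set X), 𝒰.Countable ∧ (∀ U ∈ 𝒰, IsOpen U) ∧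
    ∀ x : X, ∀ O ∈ 𝓝 x, ∃ V ∈ 𝓝 x, V ⊆ O ∧ ∀ g ∉ V, ∃ U ∈ 𝒰, g ∈ U ∧ Disjoint U V

/-! ### Sources of countable cobases -/

theorem hasCountableCobase_of_countable_basis {X : Type*} [TopologicalSpace X] [RegularSpace X]
    {B : Set (Set X)} (hB : TopologicalSpace.IsTopologicalBasis B) (hc : B.Countable) :
    HasCountableCobase X := by
  refine ⟨B, hc, fun U hU => hB.isOpen hU, fun x O hO => ?_⟩
  obtain ⟨V, hV, hVc, hVO⟩ := exists_mem_nhds_isClosed_subset hO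
  refine ⟨V, hV, hVO, fun g hg => ?_⟩
  obtain ⟨U, hU, hgU, hUV⟩ := hB.exists_subset_of_mem_open (show g ∈ Vᶜ from hg) hVc.isOpen_compl
  exact ⟨U, hU, hgU, Set.disjoint_left.2 fun a ha => hUV ha⟩

theorem Cometrizable.hasCountableCobase {X : Type*} [Countable X] [τ : TopologicalSpace X]
    (h : Cometrizable X) : HasCountableCobase X := by
  obtain ⟨σ, hle, hm, hx⟩ := h
  have hsc : @SecondCountableTopology X σ := by
    let := σ
    let := TopologicalSpace.metrizableSpaceMetric X
    exact UniformSpace.secondCountable_of_separable X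
  obtain ⟨B, hBc, -, hB⟩ := @TopologicalSpace.exists_countable_basis X σ hsc
  refine ⟨B, hBc, fun U hU => hle U (hB.isOpen hU), fun x O hO => ?_⟩
  obtain ⟨V, hV, hVO, hVc⟩ := hx x O hO
  refine ⟨V, hV, hVO, fun g hg => ?_⟩
  obtain ⟨U, hU, hgU, hUV⟩ :=
    hB.exists_subset_of_mem_open (show g ∈ Vᶜ from hg) (@IsClosed.isOpen_compl X σ V hVc)
  exact ⟨U, hU, hgU, Set.disjoint_left.2 fun a ha => hUV ha⟩

theorem Stratifiable.hasCountableCobase {X : Type*} [Countable X] [TopologicalSpace X]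
    (h : Stratifiable X) : HasCountableCobase X := by
  obtain ⟨-, U, hU, hF⟩ := h
  refine ⟨Set.range fun p : X × ℕ => U p.1 p.2, Set.countable_range _, ?_, fun x O hO => ?_⟩
  · rintro _ ⟨p, rfl⟩
    exact (hU _ _).1
  obtain ⟨W, hWO, hW, hxW⟩ := mem_nhds_iff.1 hO
  have hx : x ∉ ⋂ n, closure (⋃ y ∈ Wᶜ, U y n) := by
    rw [← hF Wᶜ hW.isClosed_compl]
    exact fun h => h hxW
  obtain ⟨n, hn⟩ : ∃ n, x ∉ closure (⋃ y ∈ Wᶜ, U y n) := by simpa using hx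
  refine ⟨(⋃ y ∈ Wᶜ, U y n)ᶜ, ?_, ?_, ?_⟩
  · exact mem_of_superset (isClosed_closure.isOpen_compl.mem_nhds hn)
      (Set.compl_subset_compl.2 subset_closure)
  · intro y hy
    by_contra hyO
    exact hy (Set.mem_biUnion (fun h => hyO (hWO h)) (hU y n).2)
  · intro g hg
    obtain ⟨y, hy, hgy⟩ := Set.mem_iUnion₂.1 (not_not.1 hg)
    exact ⟨U y n, ⟨(y, n), rfl⟩, hgy, Set.disjoint_left.2 fun a ha h =>
      h (Set.mem_biUnion hy ha)⟩

/-- A countable Fréchet–Urysohn `cs`-cosmic space whose points are separated by clopen sets. -/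
theorem CsCosmic.hasCountableCobase {X : Type*} [Countable X] [TopologicalSpace X]
    [FrechetUrysohnSpace X] (hsep : ∀ x y : X, x ≠ y → ∃ C : Set X, IsClopen C ∧ x ∈ C ∧ y ∉ C)
    (h : CsCosmic X) : HasCountableCobase X := by
  obtain ⟨h3, 𝒩, hc, hN⟩ := h
  cases isEmpty_or_nonempty X
  · exact ⟨∅, Set.countable_empty, by simp, fun x => isEmptyElim x⟩
  obtain ⟨N, hNr⟩ : ∃ N : ℕ → Set X, insert ∅ 𝒩 = Set.range N :=
    (hc.insert ∅).exists_eq_range (Set.insert_nonempty _ _)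
  obtain ⟨e, he⟩ := exists_surjective_nat X
  have : ∀ x y : X, ∃ C : Set X, IsClopen C ∧ x ∈ C ∧ (x ≠ y → y ∉ C) := fun x y => by
    by_cases hxy : x = y
    · exact ⟨Set.univ, isClopen_univ, trivial, fun h => absurd hxy h⟩
    · obtain ⟨C, h1, h2, h3⟩ := hsep x y hxy
      exact ⟨C, h1, h2, fun _ => h3⟩
  choose C hC hxC hyC using this
  -- the level sets around `x` form a partition of the complement of `x` into clopen sets
  let R : X → ℕ → Set X := fun x n => (⋂ i ∈ Finset.range n, C x (e i)) \ C x (e n)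
  have hR : ∀ x n, IsOpen (R x n) := fun x n => by
    have h1 : IsClopen (⋂ i ∈ Finset.range n, C x (e i)) :=
      isClopen_biInter_finset fun i _ => hC x (e i)
    exact (h1.diff (hC x (e n))).isOpen
  have hRx : ∀ x y, x ≠ y → ∃ n, y ∈ R x n := fun x y hxy => by
    classical
    obtain ⟨k, rfl⟩ := he y
    have hex : ∃ i, e k ∉ C x (e i) := ⟨k, hyC x _ hxy⟩
    refine ⟨Nat.find hex, ?_, Nat.find_spec hex⟩
    simp only [Finset.mem_range, Set.mem_iInter]
    exact fun i hi => not_not.1 (Nat.find_min hex hi)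
  have hRu : ∀ x y m n, y ∈ R x m → y ∈ R x n → m ≤ n := fun x y m n hm hn => by
    by_contra! hlt
    have := hm.1
    simp only [Finset.mem_range, Set.mem_iInter] at this
    exact hn.2 (this n hlt)
  let S : Set X → ℕ → Set X := fun O n => ⋃ i ∈ {i | i ≤ n ∧ closure (N i) ⊆ O}, closure (N i)
  refine ⟨Set.range fun p : X × ℕ × Finset ℕ => R p.1 p.2.1 \ ⋃ i ∈ p.2.2, closure (N i),
    Set.countable_range _, ?_, fun x O hO => ?_⟩
  · rintro _ ⟨p, rfl⟩
    exact (hR _ _).sdiff (isClosed_biUnion_finset fun i _ => isClosed_closure)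
  -- `closure (N i)` is admitted only in the pieces `R x n` with `n ≥ i`, so each piece meets this
  -- set in a finite union of closed sets, with countably many possibilities.
  refine ⟨{z | z = x ∨ z ∈ O ∧ ∃ n, z ∈ R x n ∧ ∃ i ≤ n, closure (N i) ⊆ O ∧ z ∈ closure (N i)},
    ?_, ?_, ?_⟩
  -- Otherwise a sequence outside the set tends to `x`. Some `N i` catches infinitely many terms,
  -- and late terms lie in pieces of index at least `i`, a contradiction.
  · by_contra hV
    rw [← mem_interior_iff_mem_nhds, ← Set.mem_compl_iff, ← closure_compl,
      ← seqClosure_eq_closure] at hV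
    obtain ⟨u, hu, hux⟩ := hV
    obtain ⟨W, hW, hWc, hWO⟩ := exists_mem_nhds_isClosed_subset hO
    obtain ⟨M, hM, hMW, hinf⟩ := hN (interior W) isOpen_interior x
      (mem_interior_iff_mem_nhds.2 hW) u hux
    obtain ⟨i, rfl⟩ : M ∈ Set.range N := hNr ▸ Set.mem_insert_of_mem _ hM
    have hiO : closure (N i) ⊆ O :=
      (closure_minimal (hMW.trans interior_subset) hWc).trans hWO
    have hC' : (⋂ j ∈ Finset.range i, C x (e j)) ∈ 𝓝 x :=
      (Filter.biInter_finset_mem _).2 fun j _ => (hC x (e j)).isOpen.mem_nhds (hxC _ _)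
    obtain ⟨n, hn, hnC, hnO⟩ := ((Nat.frequently_atTop_iff_infinite.2 hinf).and_eventually
      ((hux.eventually_mem hC').and (hux.eventually_mem hO))).exists
    refine hu n ?_
    by_cases hnx : u n = x
    · exact Or.inl hnx
    obtain ⟨m, hm⟩ := hRx x (u n) (Ne.symm hnx)
    refine Or.inr ⟨hnO, m, hm, i, ?_, hiO, subset_closure hn⟩
    by_contra! hlt
    exact hm.2 (Set.mem_iInter₂.1 hnC m (Finset.mem_range.2 hlt))
  · rintro z (rfl | hz)
    · exact mem_of_mem_nhds hO
    · exact hz.1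
  · intro g hg
    simp only [Set.mem_ofPred_eq, not_or] at hg
    obtain ⟨n, hn⟩ := hRx x g (Ne.symm hg.1)
    classical
    refine ⟨_, ⟨(x, n, (Finset.range (n + 1)).filter fun i => closure (N i) ⊆ O), rfl⟩,
      ⟨hn, ?_⟩, ?_⟩
    · simp only [Finset.mem_filter, Finset.mem_range, Set.mem_iUnion, not_exists]
      rintro i ⟨hi, hiO⟩ hgi
      exact hg.2 ⟨hiO hgi, n, hn, i, by omega, hiO, hgi⟩
    · refine Set.disjoint_left.2 ?_
      rintro a ⟨ha, haN⟩ (rfl | ⟨-, m, hm, i, him, hiO, hai⟩)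
      · exact ha.2 (hxC _ _)
      · have := hRu x a m n hm ha
        refine haN (Set.mem_biUnion (x := i) ?_ hai)
        simp only [Finset.coe_filter, Finset.mem_range, Set.mem_ofPred_eq]
        exact ⟨by omega, hiO⟩

/-! ### Dense countable subsets of Cantor cubes -/

theorem nhds_hasBasis_eqOn_finset {X ι : Type*} [TopologicalSpace X] {F : X → ι → Bool}
    (hF : IsInducing F) (x : X) :
    (𝓝 x).HasBasis (fun _ : Finset ι => True) fun s => {y | ∀ a ∈ s, F y a = F x a} := by
  refine ⟨fun t => ?_⟩
  simp only [hF.nhds_eq_comap, nhds_pi, nhds_discrete, mem_comap, Filter.mem_pi, true_and]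
  constructor
  · rintro ⟨T, ⟨I, hI, t, ht, hT⟩, hTt⟩
    refine ⟨hI.toFinset, fun y hy => hTt (hT fun a ha => ?_)⟩
    rw [hy a (hI.mem_toFinset.2 ha)]
    exact ht a
  · rintro ⟨s, hs⟩
    exact ⟨_, ⟨s, s.finite_toSet, fun a => {F x a}, fun a => rfl, subset_rfl⟩, fun y hy =>
      hs fun a ha => hy a ha⟩

/-- Choosing a finite support for each member at each of its points uses countably many coordinates,
so some `α` is never used. Flipping `x` at `α` leaves `V`, but a member around the flipped point
does not see `α` and so meets `V`. -/
theorem not_hasCountableCobase {X ι : Type*} [Countable X] [TopologicalSpace X] [Uncountable ι]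
    {F : X → ι → Bool} (hF : IsInducing F)
    (hd : ∀ (s : Finset ι) (v : ι → Bool), ∃ x, ∀ a ∈ s, F x a = v a) :
    ¬ HasCountableCobase X := by
  classical
  rintro ⟨𝒰, hc, ho, h⟩
  have : ∀ (U : 𝒰) (g : X), ∃ s : Finset ι, g ∈ (U : Set X) →
      {y | ∀ a ∈ s, F y a = F g a} ⊆ (U : Set X) := fun U g => by
    by_cases hg : g ∈ (U : Set X)
    · obtain ⟨s, -, hs⟩ := (nhds_hasBasis_eqOn_finset hF g).mem_iff.1
        ((ho U U.2).mem_nhds hg)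
      exact ⟨s, fun _ => hs⟩
    · exact ⟨∅, fun h => absurd h hg⟩
  choose S hS using this
  have := hc.to_subtype
  have hcS : (⋃ (U : 𝒰) (g : X), (S U g : Set ι)).Countable :=
    Set.countable_iUnion fun U => Set.countable_iUnion fun g => (S U g).countable_toSet
  obtain ⟨α, hα⟩ : ∃ α, α ∉ ⋃ (U : 𝒰) (g : X), (S U g : Set ι) := by
    by_contra! hall
    exact Set.not_countable_univ (hcS.mono fun a _ => hall a)
  obtain ⟨x, -⟩ := hd ∅ fun _ => true
  obtain ⟨V, hV, hVO, hVU⟩ := h x {y | ∀ a ∈ ({α} : Finset ι), F y a = F x a}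
    ((nhds_hasBasis_eqOn_finset hF x).mem_of_mem trivial)
  obtain ⟨T, -, hT⟩ := (nhds_hasBasis_eqOn_finset hF x).mem_iff.1 hV
  obtain ⟨g, hg⟩ := hd (insert α T) (Function.update (F x) α (!F x α))
  have hgα : F g α = !F x α := by simpa using hg α (Finset.mem_insert_self _ _)
  obtain ⟨U, hU, hgU, hdis⟩ := hVU g fun hgV => by
    have := hVO hgV α (Finset.mem_singleton_self _)
    simp [hgα] at this
  obtain ⟨y, hy⟩ := hd (S ⟨U, hU⟩ g ∪ T) fun a => if a ∈ T then F x a else F g a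
  refine (Set.disjoint_left.1 hdis : ∀ ⦃a⦄, a ∈ U → a ∉ V) (a := y)
    (hS ⟨U, hU⟩ g hgU fun a ha => ?_) (hT fun a ha => ?_)
  · rw [hy a (Finset.mem_union_left _ ha)]
    split_ifs with haT
    · have hne : a ≠ α := by
        rintro rfl
        exact hα (Set.mem_iUnion₂.2 ⟨⟨U, hU⟩, g, ha⟩)
      have := hg a (Finset.mem_insert_of_mem haT)
      rw [this, Function.update_of_ne hne]
    · rfl
  · rw [hy a (Finset.mem_union_right _ ha), if_pos ha]

theorem mk_basis_le_of_isInducing {X ι : Type} [Countable X] [TopologicalSpace X] [Infinite ι]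
    {F : X → ι → Bool} (hF : IsInducing F) :
    ∃ B : Set (Set X), TopologicalSpace.IsTopologicalBasis B ∧ #B ≤ #ι := by
  refine ⟨Set.range fun p : Finset ι × X => {y | ∀ a ∈ p.1, F y a = F p.2 a}, ?_, ?_⟩
  · refine TopologicalSpace.isTopologicalBasis_of_isOpen_of_nhds ?_ ?_
    · rintro _ ⟨⟨s, x⟩, rfl⟩
      refine isOpen_iff_mem_nhds.2 fun y hy => ?_
      refine mem_of_superset ((nhds_hasBasis_eqOn_finset hF y).mem_of_mem (i := s) trivial) ?_
      exact fun z hz a ha => (hz a ha).trans (hy a ha)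
    · intro x u hx hu
      obtain ⟨s, -, hs⟩ := (nhds_hasBasis_eqOn_finset hF x).mem_iff.1 (hu.mem_nhds hx)
      exact ⟨_, ⟨(s, x), rfl⟩, fun a _ => rfl, hs⟩
  · refine mk_range_le.trans ?_
    rw [mk_prod, lift_id, lift_id, mk_finset_of_infinite]
    exact mul_le_of_le (aleph0_le_mk ι) le_rfl ((mk_le_aleph0).trans (aleph0_le_mk ι))

theorem topWeight_eq_of_isInducing {X ι : Type} [Countable X] [TopologicalSpace X] [RegularSpace X]
    (hι : #ι = ℵ₁) {F : X → ι → Bool} (hF : IsInducing F)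
    (hd : ∀ (s : Finset ι) (v : ι → Bool), ∃ x, ∀ a ∈ s, F x a = v a) :
    topWeight X = ℵ₁ := by
  have : Uncountable ι := by
    rw [← aleph0_lt_mk_iff, hι]
    exact aleph0_lt_aleph_one
  obtain ⟨B, hB, hBc⟩ := mk_basis_le_of_isInducing hF
  refine le_antisymm ((csInf_le' (by exact ⟨B, hB, rfl⟩)).trans (hBc.trans hι.le)) ?_
  refine le_csInf ⟨_, B, hB, rfl⟩ ?_
  rintro _ ⟨B', hB', rfl⟩
  by_contra! hlt
  have : B'.Countable := by
    rw [← le_aleph0_iff_set_countable, ← Order.lt_succ_iff]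
    rwa [← succ_aleph0] at hlt
  exact not_hasCountableCobase hF hd (hasCountableCobase_of_countable_basis hB' this)

/-! ### The cardinal 𝔭 and `cs`-networks -/

theorem exists_seq_tendsto_of_lt_cardinalP {X : Type} [Countable X] {l : Filter X} {p : X}
    (hp : pure p ≤ l) (hl : l ≠ pure p) {B : Set (Set X)} (hB : l.HasBasis (· ∈ B) id)
    (hlt : #B < cardinalP) {A : Set X} (hA : ∃ᶠ x in l, x ∈ A) :
    ∃ u : ℕ → X, (∀ n, u n ∈ A) ∧ Tendsto u atTop l := by
  -- Isolating every point but `p` gives a space of the kind that defines 𝔭.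
  let Y : TopologicalSpace X := nhdsAdjoint p l
  have hYp : 𝓝 p = l := by
    rw [nhds_nhdsAdjoint_same]
    exact sup_eq_right.2 hp
  have hYq : ∀ q, q ≠ p → 𝓝 q = pure q := fun q hq => nhds_nhdsAdjoint_of_ne _ hq
  have h1 : 1 ≤ #B := by
    obtain ⟨V, hV⟩ := hB.ex_mem
    exact Cardinal.one_le_iff_ne_zero.2 (mk_ne_zero_iff.2 ⟨⟨V, hV⟩⟩)
  have hchar : topCharacter X ≤ #B := by
    refine ciSup_le' fun q => ?_
    by_cases hqp : q = p
    · subst hqp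
      exact csInf_le' ⟨B, by rwa [hYp], rfl⟩
    · have h : characterAt q ≤ #({{q}} : Set (Set X)) :=
        csInf_le' ⟨{{q}}, by rw [hYq q hqp]; exact ⟨fun t => by simp⟩, rfl⟩
      exact h.trans (by simpa using h1)
  have hFU : FrechetUrysohnSpace X := by
    by_contra hno
    have h : cardinalP ≤ topCharacter X := by
      refine csInf_le' ⟨X, Y, ‹_›, ⟨p, ?_, fun q hq => ?_⟩, hno, rfl⟩
      · exact fun ho => hl (hYp ▸ (isOpen_singleton_iff_nhds_eq_pure p).1 ho)
      · by_contra hqp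
        exact hq ((isOpen_singleton_iff_nhds_eq_pure q).2 (hYq q hqp))
    exact absurd hlt (not_lt.2 (h.trans hchar))
  rw [← hYp] at hA ⊢
  exact hFU.closure_subset_seqClosure A (mem_closure_iff_frequently.2 hA)

theorem frechetUrysohnSpace_of_lt_cardinalP {X : Type} [Countable X] [TopologicalSpace X]
    {B : Set (Set X)} (hB : TopologicalSpace.IsTopologicalBasis B) (hlt : #B < cardinalP) :
    FrechetUrysohnSpace X := by
  refine ⟨fun A p hp => ?_⟩
  rw [mem_closure_iff_frequently] at hp
  by_cases hiso : 𝓝 p = pure p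
  · rw [hiso, frequently_pure] at hp
    exact subset_seqClosure hp
  · exact exists_seq_tendsto_of_lt_cardinalP (B := {V | V ∈ B ∧ p ∈ V}) (pure_le_nhds p) hiso
      hB.nhds_hasBasis ((mk_le_mk_of_subset fun V hV => hV.1).trans_lt hlt) hp

theorem not_csCosmic_of_frechetUrysohnSpace {X ι : Type*} [Countable X] [TopologicalSpace X]
    [FrechetUrysohnSpace X] [Uncountable ι] {F : X → ι → Bool} (hF : IsEmbedding F)
    (hd : ∀ (s : Finset ι) (v : ι → Bool), ∃ x, ∀ a ∈ s, F x a = v a) : ¬ CsCosmic X := by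
  refine fun h => not_hasCountableCobase hF.isInducing hd (h.hasCountableCobase fun x y hxy => ?_)
  obtain ⟨a, ha⟩ := Function.ne_iff.1 (hF.injective.ne hxy)
  refine ⟨(fun z => F z a) ⁻¹' {F x a}, (isClopen_discrete _).preimage ?_, rfl, fun h => ha h.symm⟩
  exact (continuous_apply a).comp hF.continuous

/-- A convergent sequence with its limit is compact, hence finite, so it is eventually constant and
singletons suffice. -/
theorem csCosmic_of_finite_compacts {X : Type*} [Countable X] [TopologicalSpace X] [T3Space X]
    (h : ∀ K : Set X, IsCompact K → K.Finite) : CsCosmic X := by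
  refine ⟨‹_›, Set.range fun x : X => {x}, Set.countable_range _, fun U hU x hx s hs => ?_⟩
  refine ⟨{x}, ⟨x, rfl⟩, Set.singleton_subset_iff.2 hx, ?_⟩
  have hfin := h _ hs.isCompact_insert_range
  have hcl : IsOpen ((insert x (Set.range s)) \ {x})ᶜ :=
    (hfin.subset Set.sdiff_subset).isClosed.isOpen_compl
  have hev : ∀ᶠ n in atTop, s n = x := by
    filter_upwards [hs (hcl.mem_nhds (x := x) (by simp))] with n hn
    by_contra hne
    exact hn ⟨Or.inr ⟨n, rfl⟩, hne⟩
  exact Nat.frequently_atTop_iff_infinite.1 hev.frequently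

/-! ### Functions prescribed on few cylinders -/

/-- The map on the Cantor set prescribed by `A` and `B` on the cylinders of length `n` in `A ∪ B`,
and equal to the coordinate `z n` elsewhere. -/
def patternFun (n : ℕ) (A B : Finset (Fin n → Bool)) (z : ℕ → Bool) : Bool :=
  decide ((fun i : Fin n => z i) ∈ A ∨ (fun i : Fin n => z i) ∉ B ∧ z n = true)

theorem continuous_patternFun (n : ℕ) (A B : Finset (Fin n → Bool)) :
    Continuous (patternFun n A B) := by
  have h : Continuous fun z : ℕ → Bool => ((fun i : Fin n => z i), z n) := by fun_prop
  exact (continuous_of_discreteTopology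
    (f := fun q : (Fin n → Bool) × Bool => decide (q.1 ∈ A ∨ q.1 ∉ B ∧ q.2 = true))).comp h

/-- The maps prescribed on few cylinders, restricted to a subset of the Cantor set. -/
def patternSet (Z : Set (ℕ → Bool)) : Set (Z → Bool) :=
  {g | ∃ n A B, A.card + B.card ≤ n ∧ g = fun z : Z => patternFun n A B z}

theorem countable_patternSet (Z : Set (ℕ → Bool)) : (patternSet Z).Countable := by
  refine (Set.countable_range fun p : Σ n, Finset (Fin n → Bool) × Finset (Fin n → Bool) =>
    fun z : Z => patternFun p.1 p.2.1 p.2.2 z).mono ?_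
  rintro _ ⟨n, A, B, -, rfl⟩
  exact ⟨⟨n, A, B⟩, rfl⟩

theorem exists_mem_patternSet (Z : Set (ℕ → Bool)) (s : Finset Z) (v : Z → Bool) :
    ∃ g ∈ patternSet Z, ∀ a ∈ s, g a = v a := by
  classical
  have hsep : ∀ᶠ n in atTop, ∀ a ∈ s, ∀ b ∈ s,
      (fun i : Fin n => (a : ℕ → Bool) i) = (fun i : Fin n => (b : ℕ → Bool) i) → a = b := by
    simp only [Filter.eventually_all_finset]
    intro a _ b _
    by_cases hab : a = b
    · exact Eventually.of_forall fun _ _ => hab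
    · obtain ⟨i, hi⟩ := Function.ne_iff.1 (Subtype.coe_injective.ne hab)
      filter_upwards [eventually_gt_atTop i] with n hn h
      exact absurd (congrFun h ⟨i, hn⟩) hi
  obtain ⟨n, hn, hcard⟩ := (hsep.and (eventually_ge_atTop s.card)).exists
  let r : Z → Fin n → Bool := fun a i => (a : ℕ → Bool) i
  refine ⟨_, ⟨n, (s.filter fun a => v a = true).image r, (s.filter fun a => ¬ v a = true).image r,
    ?_, rfl⟩, fun a ha => ?_⟩
  · refine (Nat.add_le_add Finset.card_image_le Finset.card_image_le).trans ?_
    rwa [Finset.card_filter_add_card_filter_not]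
  · have hr : ∀ p : Z → Prop, ∀ [DecidablePred p],
        (fun i : Fin n => (a : ℕ → Bool) i) ∈ (s.filter p).image r ↔ p a := fun p _ => by
      simp only [Finset.mem_image, Finset.mem_filter]
      constructor
      · rintro ⟨b, ⟨hb, hpb⟩, hba⟩
        rwa [← hn b hb a ha hba]
      · exact fun hp => ⟨a, ⟨ha, hp⟩, rfl⟩
    simp only [patternFun, hr]
    cases v a <;> simp

/-- There are `2 ^ (n - k) ≥ 2 * (n - k) > n` extensions of length `n`. -/
theorem exists_extension_notMem {n k : ℕ} (hk : 2 * k + 3 ≤ n) (T : Finset (Fin n → Bool))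
    (hT : T.card ≤ n) (z : ℕ → Bool) :
    ∃ w : ℕ → Bool, (∀ i < k, w i = z i) ∧ (fun i : Fin n => w i) ∉ T := by
  by_contra! h
  let E : (Fin (n - k) → Bool) → ℕ → Bool := fun u i =>
    if i < k then z i else if hi : i - k < n - k then u ⟨i - k, hi⟩ else false
  have hE : ∀ u, (fun i : Fin n => E u i) ∈ T := fun u => h _ fun i hi => by simp [E, hi]
  have hinj : Function.Injective fun u => (⟨fun i : Fin n => E u i, hE u⟩ : T) := by
    intro u u' huu
    ext j
    have := congrFun (congrArg Subtype.val huu) ⟨j + k, by omega⟩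
    simpa [E] using this
  have hcard := Fintype.card_le_of_injective _ hinj
  simp only [Fintype.card_fun, Fintype.card_bool, Fintype.card_fin, Fintype.card_coe] at hcard
  have h1 : n - k - 1 < 2 ^ (n - k - 1) := Nat.lt_two_pow_self
  have h2 : 2 ^ (n - k) = 2 * 2 ^ (n - k - 1) := by
    rw [← pow_succ']
    congr 1
    omega
  omega

/-- By Baire, on some cylinder `f` is constant and equals all late functions. A late one has a long
unprescribed subcylinder there, on which its free coordinate takes both values. -/
theorem not_tendsto_patternFun {n : ℕ → ℕ} (hn : Tendsto n atTop atTop)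
    (A B : ∀ m, Finset (Fin (n m) → Bool)) (hAB : ∀ m, (A m).card + (B m).card ≤ n m)
    {f : (ℕ → Bool) → Bool} (hf : Continuous f) :
    ¬ ∀ z, ∀ᶠ m in atTop, patternFun (n m) (A m) (B m) z = f z := by
  classical
  intro h
  let W : ℕ → Set (ℕ → Bool) := fun k => ⋂ m ≥ k, {z | patternFun (n m) (A m) (B m) z = f z}
  have hW : ∀ k, IsClosed (W k) := fun k => isClosed_biInter fun m _ =>
    isClosed_eq (continuous_patternFun _ _ _) hf
  have hU : ⋃ k, W k = Set.univ := Set.eq_univ_of_forall fun z => by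
    obtain ⟨k, hk⟩ := eventually_atTop.1 (h z)
    exact Set.mem_iUnion.2 ⟨k, Set.mem_iInter₂.2 hk⟩
  obtain ⟨k, z, hz⟩ := nonempty_interior_of_iUnion_of_closed hW hU
  have hO : IsOpen (interior (W k) ∩ f ⁻¹' {f z}) :=
    isOpen_interior.inter ((isOpen_discrete _).preimage hf)
  obtain ⟨V, ⟨x, L, rfl⟩, hzV, hVO⟩ :=
    (PiNat.isTopologicalBasis_cylinders fun _ : ℕ => Bool).exists_subset_of_mem_open
      (show z ∈ interior (W k) ∩ f ⁻¹' {f z} from ⟨hz, rfl⟩) hO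
  obtain ⟨m, hm, hmk⟩ :=
    ((hn.eventually_ge_atTop (2 * L + 3)).and (eventually_ge_atTop k)).exists
  obtain ⟨w, hwx, hwT⟩ := exists_extension_notMem hm (A m ∪ B m)
    ((Finset.card_union_le _ _).trans (hAB m)) x
  rw [Finset.notMem_union] at hwT
  have key : ∀ b : Bool, f z = b := fun b => by
    have hmem : Function.update w (n m) b ∈ PiNat.cylinder x L := fun i hi => by
      rw [Function.update_of_ne (by omega), hwx i hi]
    have hb := hVO hmem
    have h1 := Set.mem_iInter₂.1 (interior_subset hb.1) m hmk
    have hr : (fun i : Fin (n m) => Function.update w (n m) b i) = fun i : Fin (n m) => w i := by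
      ext i
      rw [Function.update_of_ne (by omega)]
    rw [← show f _ = f z from hb.2, ← show _ = f _ from h1]
    simp [patternFun, hr, hwT.1, hwT.2]
  exact absurd ((key true).symm.trans (key false)) (by simp)

/-- Countably many coordinates separate the points of a countable space, so compact subsets are
second countable. -/
theorem IsCompact.exists_injective_seq_tendsto {X ι : Type*} [Countable X] [TopologicalSpace X]
    {F : X → ι → Bool} (hF : IsEmbedding F) {K : Set X} (hK : IsCompact K) (hinf : K.Infinite) :
    ∃ (u : ℕ → X) (a : X), Function.Injective u ∧ Tendsto u atTop (𝓝 a) := by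
  have : ∀ p : {p : X × X // p.1 ≠ p.2}, ∃ a, F p.1.1 a ≠ F p.1.2 a :=
    fun p => Function.ne_iff.1 (hF.injective.ne p.2)
  choose d hd using this
  have := isCompact_iff_compactSpace.1 hK
  have := hinf.to_subtype
  let G : K → {p : X × X // p.1 ≠ p.2} → Bool := fun x p => F x (d p)
  have hG : Continuous G := continuous_pi fun p =>
    (continuous_apply (d p)).comp (hF.continuous.comp continuous_subtype_val)
  have hGi : Function.Injective G := fun x y hxy => by
    by_contra hne
    exact hd ⟨(x, y), Subtype.coe_injective.ne hne⟩ (congrFun hxy ⟨(x, y), _⟩)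
  have : SecondCountableTopology K :=
    (hG.isClosedEmbedding hGi).isEmbedding.secondCountableTopology
  obtain ⟨a, φ, hφ, ha⟩ := SeqCompactSpace.tendsto_subseq fun m => Infinite.natEmbedding K m
  exact ⟨_, a, Subtype.coe_injective.comp
    ((Infinite.natEmbedding K).injective.comp hφ.injective),
    (continuous_subtype_val.tendsto a).comp ha⟩

theorem finite_of_isCompact_of_patternSet {X : Type*} [Countable X] [TopologicalSpace X]
    {F : X → ↥(Set.univ : Set (ℕ → Bool)) → Bool} (hF : IsEmbedding F)
    (hFX : ∀ x, F x ∈ patternSet Set.univ) {K : Set X} (hK : IsCompact K) : K.Finite := by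
  by_contra hinf
  obtain ⟨u, a, hu, hua⟩ := hK.exists_injective_seq_tendsto hF hinf
  choose n A B hAB hg using hFX
  have hinj : Function.Injective fun x : X =>
      (⟨n x, A x, B x⟩ : Σ n, Finset (Fin n → Bool) × Finset (Fin n → Bool)) := fun x y hxy => by
    refine hF.injective ?_
    rw [hg x, hg y]
    exact congrArg (fun p : Σ n, Finset (Fin n → Bool) × Finset (Fin n → Bool) =>
      fun z : (Set.univ : Set (ℕ → Bool)) => patternFun p.1 p.2.1 p.2.2 z) hxy
  have hfst : Tendsto (Sigma.fst : (Σ n, Finset (Fin n → Bool) × Finset (Fin n → Bool)) → ℕ)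
      cofinite atTop := by
    refine tendsto_atTop.2 fun b => ?_
    refine ((Set.finite_Iio b).biUnion fun i _ => Set.finite_range (Sigma.mk i)).subset
      fun p hp => ?_
    exact Set.mem_biUnion (Set.mem_Iio.2 (not_le.1 hp)) ⟨p.2, rfl⟩
  -- Each length carries finitely many patterns, so distinct points force the lengths to infinity.
  have hn : Tendsto (fun m => n (u m)) atTop atTop := by
    have := hfst.comp (hinj.comp hu).tendsto_cofinite
    rwa [Nat.cofinite_eq_atTop] at this
  refine not_tendsto_patternFun hn (fun m => A (u m)) (fun m => B (u m)) (fun m => hAB _)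
    (continuous_patternFun (n a) (A a) (B a)) fun z => ?_
  have h1 : Tendsto (fun m => F (u m) ⟨z, trivial⟩) atTop (𝓝 (F a ⟨z, trivial⟩)) :=
    ((continuous_apply _).comp hF.continuous).continuousAt.tendsto.comp hua
  rw [nhds_discrete, tendsto_pure] at h1
  filter_upwards [h1] with m hm
  rwa [hg (u m), hg a] at hm

/-! ### Construction of the topology -/

theorem exists_topology_of_countable_infinite (X : Type) [Countable X] [Infinite X] :
    ∃ τ : TopologicalSpace X,
      @T3Space X τ ∧ @topWeight X τ = ℵ₁ ∧
      ¬ @Cometrizable X τ ∧ ¬ @Stratifiable X τ ∧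
      ((ℵ₁ : Cardinal.{0}) = 𝔠 →
        (∀ K : Set X, @IsCompact X τ K → K.Finite) ∧ @CsCosmic X τ) ∧
      ((ℵ₁ : Cardinal.{0}) < cardinalP →
        @FrechetUrysohnSpace X τ ∧ ¬ @CsCosmic X τ) := by
  have hmk : #(ℕ → Bool) = 𝔠 := by simp
  obtain ⟨Z, hZ, hZu⟩ : ∃ Z : Set (ℕ → Bool), #Z = ℵ₁ ∧ ((ℵ₁ : Cardinal.{0}) = 𝔠 →
      Z = Set.univ) := by
    by_cases hCH : (ℵ₁ : Cardinal.{0}) = 𝔠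
    · exact ⟨Set.univ, by rw [mk_univ, hmk, hCH], fun _ => rfl⟩
    · obtain ⟨Z, hZ⟩ := le_mk_iff_exists_set.1 (aleph_one_le_continuum.trans hmk.ge)
      exact ⟨Z, hZ, fun h => absurd h hCH⟩
  have hZunc : Uncountable Z := by
    rw [← aleph0_lt_mk_iff, hZ]
    exact aleph0_lt_aleph_one
  -- Evaluation embeds `Z` into the functions from `patternSet Z` to `Bool`, so finiteness would
  -- make `Z` finite.
  have hinf : Infinite (patternSet Z) := by
    by_contra hfin
    rw [not_infinite_iff_finite] at hfin
    have hinj : Function.Injective fun (z : Z) (g : patternSet Z) => g.1 z := fun z w hzw => by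
      classical
      by_contra hne
      obtain ⟨g, hg, hgv⟩ := exists_mem_patternSet Z {z, w} fun a => decide (a = z)
      have h1 := hgv z (by simp)
      have h2 := hgv w (by simp)
      have h3 : g z = g w := congrFun hzw ⟨g, hg⟩
      rw [h1, h2] at h3
      simp [Ne.symm hne] at h3
    exact not_countable (α := Z) (Finite.of_injective _ hinj).to_countable
  have := (countable_patternSet Z).to_subtype
  obtain ⟨e⟩ : Nonempty (X ≃ patternSet Z) := nonempty_equiv_of_countable
  let F : X → Z → Bool := fun q => (e q).1
  have hd : ∀ (s : Finset Z) (v : Z → Bool), ∃ x, ∀ a ∈ s, F x a = v a := fun s v => by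
    obtain ⟨g, hg, hgv⟩ := exists_mem_patternSet Z s v
    exact ⟨e.symm ⟨g, hg⟩, by simpa [F] using hgv⟩
  have hFinj : Function.Injective F := Subtype.coe_injective.comp e.injective
  have hFX : ∀ q, F q ∈ patternSet Z := fun q => (e q).2
  clear_value F
  let τ : TopologicalSpace X := TopologicalSpace.induced F inferInstance
  have hF : @IsEmbedding X (Z → Bool) τ _ F := @IsEmbedding.mk _ _ τ _ _ ⟨rfl⟩ hFinj
  have h3 : T3Space X := hF.t3Space
  obtain ⟨B, hB, hBc⟩ := mk_basis_le_of_isInducing hF.isInducing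
  have hnot := not_hasCountableCobase hF.isInducing hd
  refine ⟨τ, h3, topWeight_eq_of_isInducing hZ hF.isInducing hd,
    fun h => hnot h.hasCountableCobase, fun h => hnot h.hasCountableCobase, fun hCH => ?_,
    fun hp => ?_⟩
  · obtain rfl := hZu hCH
    have hK : ∀ K : Set X, IsCompact K → K.Finite := fun K hK =>
      finite_of_isCompact_of_patternSet hF hFX hK
    exact ⟨hK, csCosmic_of_finite_compacts hK⟩
  · have hFU : FrechetUrysohnSpace X :=
      frechetUrysohnSpace_of_lt_cardinalP hB ((hBc.trans hZ.le).trans_lt hp)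
    exact ⟨hFU, not_csCosmic_of_frechetUrysohnSpace hF hd⟩

theorem mainTheorem3 :
    ∃ τ : TopologicalSpace ℚ,
      @T3Space ℚ τ ∧ @topWeight ℚ τ = ℵ₁ ∧
      ¬ @Cometrizable ℚ τ ∧ ¬ @Stratifiable ℚ τ ∧
      ((ℵ₁ : Cardinal.{0}) = 𝔠 →
        (∀ K : Set ℚ, @IsCompact ℚ τ K → K.Finite) ∧ @CsCosmic ℚ τ) ∧
      ((ℵ₁ : Cardinal.{0}) < cardinalP →
        @FrechetUrysohnSpace ℚ τ ∧ ¬ @CsCosmic ℚ τ) :=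
  exists_topology_of_countable_infinite ℚ
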